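/- Let $\xi=(\xi_k)_{k\ge 0}$ be an i.i.d. sequence of $\mathbf R^Z$-valued random vectors on a probability space, and let $\boldsymbol\Xi\subset\mathbf R^Z$ be the support of the law of $\xi_0$. Consider the discrete-time linear system $G$ $$x_{k+1}=A(\xi_k)x_k+B(\xi_k)w_k,\qquad z_k=C(\xi_k)x_k+D(\xi_k)w_k,$$ with deterministic initial state $x_0\in\mathbf R^n$, where $A,B,C,D$ are Borel functions on $\boldsymbol\Xi$ with values in $\mathbf R^{n\times n}$, $\mathbf R^{n\times p}$, $\mathbf R^{q\times n}$, $\mathbf R^{q\times p}$ respectively, such that the squares of all entries of $A(\xi_0)$, $B(\xi_0)$, $C(\xi_0)$, $D(\xi_0)$ are integrable. Call $G$ exponentially stable in the second moment if there are $a>0$ and $\lambda\in(0,1)$ such that, for $w\equiv 0$, $\sqrt{E[\|x_k\|^2]}\le a\|x_0\|\lambda^k$ for all $k\ge 0$ and all $x_0\in\mathbf R^n$. For $k\ge 1$ let $\Phi_1^k=A(\xi_{k-1})A(\xi_{k-2})\cdots A(\xi_1)$ (so $\Phi_1^1=I$), and let $$s_K=E[\operatorname{tr}(D(\xi_0)^TD(\xi_0))]+\sum_{k=1}^K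 E\big[\operatorname{tr}\big(B(\xi_0)^T(\Phi_1^k)^TC(\xi_k)^TC(\xi_k)\Phi_1^kB(\xi_0)\big)\big].$$ If $G$ is exponentially stable in the second moment, then $s_K$ converges to a finite limit $s_\infty$ as $K\to\infty$, and the $H_2$ norm of $G$ is $\|G\|_2:=\sqrt{s_\infty}$. Moreover, for every given $\gamma>0$, the following two conditions are equivalent. 1. The system $G$ is exponentially stable in the second moment and $\|G\|_2<\gamma$. 2. There exists a symmetric positive definite matrix $P\in\mathbf R^{n\times n}$ such that $E[P-A(\xi_0)^TPA(\xi_0)-C(\xi_0)^TC(\xi_0)]$ is positive definite and $E[\operatorname{tr}(D(\xi_0)^TD(\xi_0)+B(\xi_0)^TPB(\xi_0))]<\gamma^2$. -/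

import Mathlib

open MeasureTheory ProbabilityTheory Filter Topology Matrix

noncomputable section

namespace H2Stoch

/-- The coefficients of the system `x_{k+1} = A(ξ_k) x_k + B(ξ_k) w_k`,
`z_k = C(ξ_k) x_k + D(ξ_k) w_k`, driven by a `Z`-dimensional process `ξ`, with state dimension
`n`, input dimension `p` and output dimension `q`.  The coefficients are written as functions on
all of `ℝ^Z`; only their values on the support of the law of `ξ_k` matter. -/
structure System (Z n p q : ℕ) where
  /-- state to state -/
  A : EuclideanSpace ℝ (Fin Z) → Matrix (Fin n) (Fin n) ℝ
  /-- input to state -/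
  B : EuclideanSpace ℝ (Fin Z) → Matrix (Fin n) (Fin p) ℝ
  /-- state to output -/
  C : EuclideanSpace ℝ (Fin Z) → Matrix (Fin q) (Fin n) ℝ
  /-- input to output -/
  D : EuclideanSpace ℝ (Fin Z) → Matrix (Fin q) (Fin p) ℝ

variable {Ω : Type*} [MeasurableSpace Ω] {Z n p q : ℕ}

/-- `ξ` is a sequence of independent and identically distributed random vectors. -/
structure IsIID (μ : Measure Ω) (ξ : ℕ → Ω → EuclideanSpace ℝ (Fin Z)) : Prop where
  measurable : ∀ k, Measurable (ξ k)
  indep : iIndepFun ξ μ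
  ident : ∀ k, IdentDistrib (ξ k) (ξ 0) μ μ

/-- The topological support of the (time-invariant) law of `ξ_k`. -/
def supp (μ : Measure Ω) (ξ : ℕ → Ω → EuclideanSpace ℝ (Fin Z)) :
    Set (EuclideanSpace ℝ (Fin Z)) :=
  (μ.map (ξ 0)).support

/-- A matrix-valued function that is Borel on the support of `ξ_0`. -/
def IsBorelOnSupp (μ : Measure Ω) (ξ : ℕ → Ω → EuclideanSpace ℝ (Fin Z)) {r c : ℕ}
    (M : EuclideanSpace ℝ (Fin Z) → Matrix (Fin r) (Fin c) ℝ) : Prop :=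
  ∀ i j, Measurable fun s : supp μ ξ => M s i j

/-- The squares of all entries of the random matrix `M(ξ_0)` are integrable. -/
def HasSqIntegrableEntries (μ : Measure Ω) (ξ : ℕ → Ω → EuclideanSpace ℝ (Fin Z)) {r c : ℕ}
    (M : EuclideanSpace ℝ (Fin Z) → Matrix (Fin r) (Fin c) ℝ) : Prop :=
  ∀ i j, Integrable (fun ω => (M (ξ 0 ω) i j) ^ 2) μ

/-- The coefficients are Borel functions on the support of `ξ_0`, and the squares of the entries
of `A(ξ_0)`, `B(ξ_0)`, `C(ξ_0)`, `D(ξ_0)` are integrable. -/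
structure System.IsSqIntegrable (G : System Z n p q) (μ : Measure Ω)
    (ξ : ℕ → Ω → EuclideanSpace ℝ (Fin Z)) : Prop where
  borel_A : IsBorelOnSupp μ ξ G.A
  borel_B : IsBorelOnSupp μ ξ G.B
  borel_C : IsBorelOnSupp μ ξ G.C
  borel_D : IsBorelOnSupp μ ξ G.D
  sq_A : HasSqIntegrableEntries μ ξ G.A
  sq_B : HasSqIntegrableEntries μ ξ G.B
  sq_C : HasSqIntegrableEntries μ ξ G.C
  sq_D : HasSqIntegrableEntries μ ξ G.D

/-- The state `x_k` for the input `w` and the deterministic initial state `x₀`. -/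
def System.state (G : System Z n p q) (ξ : ℕ → Ω → EuclideanSpace ℝ (Fin Z))
    (w : ℕ → Ω → Fin p → ℝ) (x₀ : Fin n → ℝ) : ℕ → Ω → Fin n → ℝ
  | 0, _ => x₀
  | k + 1, ω => G.A (ξ k ω) *ᵥ G.state ξ w x₀ k ω + G.B (ξ k ω) *ᵥ w k ω

/-- The output `z_k` for the input `w` and the deterministic initial state `x₀`. -/
def System.output (G : System Z n p q) (ξ : ℕ → Ω → EuclideanSpace ℝ (Fin Z))
    (w : ℕ → Ω → Fin p → ℝ) (x₀ : Fin n → ℝ) (k : ℕ) (ω : Ω) : Fin q → ℝ :=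
  G.C (ξ k ω) *ᵥ G.state ξ w x₀ k ω + G.D (ξ k ω) *ᵥ w k ω

/-- The Euclidean norm of a vector. -/
def euclNorm {m : ℕ} (v : Fin m → ℝ) : ℝ := ‖WithLp.toLp 2 v‖

/-- Exponential stability in the second moment: with zero input, the second moments of the state
are finite and `√E[‖x_k‖²] ≤ a ‖x₀‖ lam^k` for some `a > 0` and `0 < lam < 1` that do not depend
on `k` and `x₀`. -/
def System.IsExpStable (G : System Z n p q) (μ : Measure Ω)
    (ξ : ℕ → Ω → EuclideanSpace ℝ (Fin Z)) : Prop :=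
  ∃ a lam : ℝ, 0 < a ∧ 0 < lam ∧ lam < 1 ∧ ∀ (k : ℕ) (x₀ : Fin n → ℝ),
    Integrable (fun ω => euclNorm (G.state ξ 0 x₀ k ω) ^ 2) μ ∧
    √(∫ ω, euclNorm (G.state ξ 0 x₀ k ω) ^ 2 ∂μ) ≤ a * euclNorm x₀ * lam ^ k

/-- The random transition matrix from time `k₁` to time `k₂ ≥ k₁`: the identity for `k₂ = k₁`,
and `A(ξ_{k₂-1}) ⋯ A(ξ_{k₁})` for `k₂ > k₁`. -/
def System.transition (G : System Z n p q) (ξ : ℕ → Ω → EuclideanSpace ℝ (Fin Z)) (k₁ : ℕ) :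
    ℕ → Ω → Matrix (Fin n) (Fin n) ℝ
  | 0, _ => 1
  | k + 1, ω => if k₁ ≤ k then G.A (ξ k ω) * G.transition ξ k₁ k ω else 1

theorem System.transition_self {Ω : Type*} (G : System Z n p q)
    (ξ : ℕ → Ω → EuclideanSpace ℝ (Fin Z)) (k : ℕ) (ω : Ω) : G.transition ξ k k ω = 1 := by
  cases k <;> simp [System.transition]

theorem System.transition_succ {Ω : Type*} (G : System Z n p q)
    (ξ : ℕ → Ω → EuclideanSpace ℝ (Fin Z)) {k₁ k : ℕ} (h : k₁ ≤ k) (ω : Ω) :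
    G.transition ξ k₁ (k + 1) ω = G.A (ξ k ω) * G.transition ξ k₁ k ω := by
  simp [System.transition, h]

/-- The expected square sum `s_K` of the impulse response over the times `0, …, K`. -/
def System.impulseSum (G : System Z n p q) (μ : Measure Ω)
    (ξ : ℕ → Ω → EuclideanSpace ℝ (Fin Z)) (K : ℕ) : ℝ :=
  (∫ ω, ((G.D (ξ 0 ω))ᵀ * G.D (ξ 0 ω)).trace ∂μ) +
    ∑ k ∈ Finset.Icc 1 K, ∫ ω, ((G.B (ξ 0 ω))ᵀ * (G.transition ξ 1 k ω)ᵀ * (G.C (ξ k ω))ᵀ *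
      G.C (ξ k ω) * G.transition ξ 1 k ω * G.B (ξ 0 ω)).trace ∂μ

/-- The `H₂` norm `√(lim_{K → ∞} s_K)`. -/
def System.h2Norm (G : System Z n p q) (μ : Measure Ω)
    (ξ : ℕ → Ω → EuclideanSpace ℝ (Fin Z)) : ℝ :=
  √(limUnder atTop (G.impulseSum μ ξ))

/-- The entrywise expectation of a random matrix. -/
def matExp (μ : Measure Ω) {r c : ℕ} (M : Ω → Matrix (Fin r) (Fin c) ℝ) :
    Matrix (Fin r) (Fin c) ℝ :=
  Matrix.of fun i j => ∫ ω, M ω i j ∂μ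

end H2Stoch

end

/-! Write `L P = E[Aᵀ P A]`, `Q = E[Cᵀ C]`, `β P = E[tr(Bᵀ P B)]` and `d = E[tr(Dᵀ D)]`. Since `ξ_k`
is independent of the past, averaging out one random factor at a time gives `E‖x_k‖² = x₀ᵀ (L^k 1)
x₀`, and the impulse term at time `1 + k` equals `β (L^k Q)`. So stability means geometric decay of
`L^k 1`, and `s_∞ = d + ∑ β (L^k Q)`. What remains is deterministic: it concerns a positive linear
map `L` and a positive functional `β`.

If `P - L P - Q` is positive definite, then `L P ≤ ρ P` for some `ρ < 1`, which gives decay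
(`hasGeomDecay_of_lyapunov`), and telescoping gives `∑ β (L^k Q) ≤ β P` (`tsum_le_of_lyapunov`).
Conversely, the series `∑ L^k Q` would solve the Lyapunov equation only with equality and might be
singular. Replacing `Q` by `Q + ε 1` and truncating the series makes both inequalities strict at
arbitrarily small extra cost (`HasGeomDecay.exists_lyapunov`).

The probabilistic link is `IsIID.trajectory` and `System.integral_impulse_term`. Coefficients that
are Borel only on the support are extended by zero, which almost surely changes nothing. -/

namespace H2Stoch

/-! ### Positive linear maps on matrices and the strict Lyapunov inequality. -/

section QuadraticForms

/-- The quadratic form `xᵀ P x`. -/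
def quad {n : ℕ} (P : Matrix (Fin n) (Fin n) ℝ) (x : Fin n → ℝ) : ℝ := x ⬝ᵥ P *ᵥ x

section Quad

variable {n : ℕ} (P R : Matrix (Fin n) (Fin n) ℝ) (x : Fin n → ℝ) (c : ℝ)

theorem quad_add : quad (P + R) x = quad P x + quad R x := by
  simp [quad, add_mulVec]

theorem quad_sub : quad (P - R) x = quad P x - quad R x := by
  simp [quad, sub_mulVec]

theorem quad_smul : quad (c • P) x = c * quad P x := by
  simp [quad, smul_mulVec]

theorem quad_one : quad 1 x = x ⬝ᵥ x := by simp [quad]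

theorem quad_sum {ι : Type*} (s : Finset ι) (P : ι → Matrix (Fin n) (Fin n) ℝ) :
    quad (∑ i ∈ s, P i) x = ∑ i ∈ s, quad (P i) x := by
  simp [quad, sum_mulVec, dotProduct_sum]

theorem quad_vec_smul : quad P (c • x) = c ^ 2 * quad P x := by
  simp [quad, mulVec_smul]; ring

theorem continuous_quad : Continuous (quad P) := by
  unfold quad; fun_prop

theorem quad_eq_sum : quad P x = ∑ i, ∑ j, P i j * (x i * x j) := by
  simp only [quad, dotProduct, mulVec, Finset.mul_sum]
  exact Finset.sum_congr rfl fun i _ => Finset.sum_congr rfl fun j _ => by ring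

end Quad

theorem quad_mulVec {r n : ℕ} (P : Matrix (Fin r) (Fin r) ℝ) (M : Matrix (Fin r) (Fin n) ℝ)
    (x : Fin n → ℝ) : quad P (M *ᵥ x) = quad (Mᵀ * P * M) x := by
  rw [quad, quad, ← mulVec_mulVec, ← mulVec_mulVec, dotProduct_mulVec x, vecMul_transpose]

variable {n : ℕ} {P R Q : Matrix (Fin n) (Fin n) ℝ}

/-- The quadratic form of `P` is nonnegative (no symmetry is required). -/
def QNonneg (P : Matrix (Fin n) (Fin n) ℝ) : Prop := ∀ x, 0 ≤ quad P x

theorem posDef_iff_quad : P.PosDef ↔ Pᵀ = P ∧ ∀ x, x ≠ 0 → 0 < quad P x := by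
  rw [posDef_iff_dotProduct_mulVec]
  simp [IsHermitian, quad]

theorem qNonneg_of_posDef (h : P.PosDef) : QNonneg P := by
  intro x
  by_cases hx : x = 0
  · simp [hx, quad]
  · exact ((posDef_iff_quad.1 h).2 x hx).le

theorem qNonneg_one : QNonneg (1 : Matrix (Fin n) (Fin n) ℝ) := fun x => by
  rw [quad_one]; exact dotProduct_self_star_nonneg x

theorem QNonneg.add (hP : QNonneg P) (hR : QNonneg R) : QNonneg (P + R) := fun x => by
  rw [quad_add]; exact add_nonneg (hP x) (hR x)

theorem QNonneg.smul {c : ℝ} (hc : 0 ≤ c) (hP : QNonneg P) : QNonneg (c • P) := fun x => by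
  rw [quad_smul]; exact mul_nonneg hc (hP x)

/-- Every quadratic form is dominated by a multiple of a positive definite one. -/
theorem exists_quad_le (P : Matrix (Fin n) (Fin n) ℝ) (hR : R.PosDef) :
    ∃ c : ℝ, 1 < c ∧ ∀ x, quad P x ≤ c * quad R x := by
  have hpos := (posDef_iff_quad.1 hR).2
  have hne : ∀ x ∈ Metric.sphere (0 : Fin n → ℝ) 1, x ≠ 0 := by
    rintro x hx rfl
    simp at hx
  -- The ratio of the two forms is homogeneous of degree 0, so a bound on the compact unit sphere
  -- suffices.
  have hcont : ContinuousOn (fun x => quad P x / quad R x) (Metric.sphere (0 : Fin n → ℝ) 1) :=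
    (continuous_quad P).continuousOn.div (continuous_quad R).continuousOn
      fun x hx => (hpos x (hne x hx)).ne'
  obtain ⟨c, hc⟩ := (isCompact_sphere (0 : Fin n → ℝ) 1).bddAbove_image hcont
  -- Forcing the constant above 1 makes `1 - c⁻¹` a valid contraction rate later.
  refine ⟨max c 2, lt_of_lt_of_le one_lt_two (le_max_right _ _), fun x => ?_⟩
  by_cases hx : x = 0
  · simp [hx, quad]
  have hx' : ‖x‖ ≠ 0 := norm_ne_zero_iff.2 hx
  have hy : ‖x‖⁻¹ • x ∈ Metric.sphere (0 : Fin n → ℝ) 1 := by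
    simp [norm_smul, hx']
  have h1 := hc ⟨_, hy, rfl⟩
  simp only at h1
  rw [quad_vec_smul, quad_vec_smul, mul_div_mul_left _ _ (by positivity),
    div_le_iff₀ (hpos x hx)] at h1
  exact h1.trans (mul_le_mul_of_nonneg_right (le_max_left _ _) (hpos x hx).le)

/-- The linear map `L` preserves nonnegativity of quadratic forms. -/
def IsPositiveMap (L : Matrix (Fin n) (Fin n) ℝ →ₗ[ℝ] Matrix (Fin n) (Fin n) ℝ) : Prop :=
  ∀ P, QNonneg P → QNonneg (L P)

/-- The iterates of `L` at the identity decay geometrically. -/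
def HasGeomDecay (L : Matrix (Fin n) (Fin n) ℝ →ₗ[ℝ] Matrix (Fin n) (Fin n) ℝ) : Prop :=
  ∃ a ρ : ℝ, 0 < a ∧ 0 < ρ ∧ ρ < 1 ∧ ∀ (k : ℕ) x, quad ((L ^ k) 1) x ≤ a * ρ ^ k * (x ⬝ᵥ x)

variable {L : Matrix (Fin n) (Fin n) ℝ →ₗ[ℝ] Matrix (Fin n) (Fin n) ℝ}
  {β : Matrix (Fin n) (Fin n) ℝ →ₗ[ℝ] ℝ}

theorem IsPositiveMap.pow (hL : IsPositiveMap L) (k : ℕ) : IsPositiveMap (L ^ k) := by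
  induction k with
  | zero => intro P hP; simpa using hP
  | succ k ih => intro P hP; rw [pow_succ']; exact hL _ (ih _ hP)

theorem IsPositiveMap.mono (hL : IsPositiveMap L) (h : ∀ x, quad P x ≤ quad R x)
    (x : Fin n → ℝ) : quad (L P) x ≤ quad (L R) x := by
  have := hL (R - P) (fun x => by rw [quad_sub]; linarith [h x]) x
  rw [map_sub, quad_sub] at this
  linarith

theorem positive_mono (hβ : ∀ P, QNonneg P → 0 ≤ β P) (h : ∀ x, quad P x ≤ quad R x) :
    β P ≤ β R := by
  have := hβ (R - P) (fun x => by rw [quad_sub]; linarith [h x])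
  rw [map_sub] at this
  linarith

/-- The positive map `L ^ k` preserves the one-step inequality `L P ≤ ρ P`, so the factor `ρ`
accumulates. -/
theorem quad_pow_le_of_le_smul (hL : IsPositiveMap L) {ρ : ℝ} (hρ : 0 ≤ ρ)
    (h : ∀ x, quad (L P) x ≤ ρ * quad P x) (k : ℕ) (x : Fin n → ℝ) :
    quad ((L ^ k) P) x ≤ ρ ^ k * quad P x := by
  induction k generalizing x with
  | zero => simp
  | succ k ih =>
    have h1 := (hL.pow k).mono (P := L P) (R := ρ • P) (fun x => by rw [quad_smul]; exact h x) x
    rw [map_smul, quad_smul] at h1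
    rw [pow_succ, Module.End.mul_apply, pow_succ']
    calc _ ≤ _ := h1
      _ ≤ ρ * (ρ ^ k * quad P x) := mul_le_mul_of_nonneg_left (ih x) hρ
      _ = _ := by ring

/-- A strict Lyapunov inequality forces geometric decay. -/
theorem hasGeomDecay_of_lyapunov (hL : IsPositiveMap L) (hQ : QNonneg Q) (hP : P.PosDef)
    (hR : (P - L P - Q).PosDef) : HasGeomDecay L := by
  obtain ⟨c, hc, hPc⟩ := exists_quad_le P hR
  obtain ⟨c₁, hc₁, h₁⟩ := exists_quad_le 1 hP
  obtain ⟨c₂, hc₂, h₂⟩ := exists_quad_le P (R := (1 : Matrix (Fin n) (Fin n) ℝ)) .one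
  have hc0 : 0 < c := by linarith
  have hci : c⁻¹ < 1 := inv_lt_one_of_one_lt₀ hc
  have hci0 : 0 < c⁻¹ := inv_pos.2 hc0
  -- With `R = P - L P - Q`, the bound `P ≤ c R` gives `L P ≤ (1 - c⁻¹) P - Q`, and `Q` is
  -- nonnegative.
  have hstep : ∀ x, quad (L P) x ≤ (1 - c⁻¹) * quad P x := fun x => by
    have h3 : c⁻¹ * quad P x ≤ quad (P - L P - Q) x := by
      rw [inv_mul_le_iff₀ hc0]; exact hPc x
    rw [quad_sub, quad_sub] at h3
    linarith [hQ x]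
  -- The contraction holds at `P`; the comparisons `1 ≤ c₁ P` and `P ≤ c₂ 1` transfer it to the
  -- identity.
  refine ⟨c₁ * c₂, 1 - c⁻¹, by positivity, by linarith, by linarith, fun k x => ?_⟩
  have h4 := (hL.pow k).mono (P := 1) (R := c₁ • P) (fun x => by rw [quad_smul]; exact h₁ x) x
  rw [map_smul, quad_smul] at h4
  have h5 := quad_pow_le_of_le_smul hL (by linarith) hstep k x
  have h6 := h₂ x
  rw [quad_one] at h6
  have hρ : 0 ≤ (1 - c⁻¹) ^ k := pow_nonneg (by linarith) k
  calc _ ≤ _ := h4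
    _ ≤ c₁ * ((1 - c⁻¹) ^ k * (c₂ * (x ⬝ᵥ x))) := by gcongr; exact h5.trans (by gcongr)
    _ = _ := by ring

/-- Since `Q ≤ c 1`, decay at the identity controls every matrix. The bound is stated as a quadratic
form so that `positive_mono` applies to it. -/
theorem HasGeomDecay.exists_bound (h : HasGeomDecay L) (hL : IsPositiveMap L)
    (Q : Matrix (Fin n) (Fin n) ℝ) :
    ∃ a ρ : ℝ, 0 < a ∧ 0 < ρ ∧ ρ < 1 ∧ ∀ (k : ℕ) x,
      quad ((L ^ k) Q) x ≤ quad ((a * ρ ^ k) • (1 : Matrix (Fin n) (Fin n) ℝ)) x := by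
  obtain ⟨a, ρ, ha, hρ, hρ1, hk⟩ := h
  obtain ⟨c, hc, hQ⟩ := exists_quad_le Q (R := (1 : Matrix (Fin n) (Fin n) ℝ)) .one
  refine ⟨c * a, ρ, by positivity, hρ, hρ1, fun k x => ?_⟩
  have h1 := (hL.pow k).mono (P := Q) (R := c • 1) (fun x => by rw [quad_smul]; exact hQ x) x
  rw [map_smul, quad_smul] at h1
  rw [quad_smul, quad_one]
  calc _ ≤ _ := h1
    _ ≤ c * (a * ρ ^ k * (x ⬝ᵥ x)) := by gcongr; exact hk k x
    _ = _ := by ring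

theorem HasGeomDecay.summable (h : HasGeomDecay L) (hL : IsPositiveMap L)
    (hβ : ∀ P, QNonneg P → 0 ≤ β P) (hQ : QNonneg Q) :
    Summable fun k : ℕ => β ((L ^ k) Q) := by
  obtain ⟨a, ρ, ha, hρ, hρ1, hk⟩ := h.exists_bound hL Q
  refine Summable.of_nonneg_of_le (fun k => hβ _ (hL.pow k _ hQ))
    (fun k => positive_mono hβ (hk k)) ?_
  simp only [map_smul, smul_eq_mul]
  exact ((summable_geometric_of_lt_one hρ.le hρ1).mul_left a).mul_right _

/-- Applying `β ∘ L ^ k` to `0 ≤ P - L P - Q` gives `β (L^k Q) ≤ β (L^k P) - β (L^(k+1) P)`. The sum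
telescopes, and the remainder `β (L^N P)` is nonnegative. -/
theorem tsum_le_of_lyapunov (hL : IsPositiveMap L) (hβ : ∀ P, QNonneg P → 0 ≤ β P)
    (hQ : QNonneg Q) (hP : P.PosDef) (hR : (P - L P - Q).PosDef) :
    ∑' k : ℕ, β ((L ^ k) Q) ≤ β P := by
  have hbound : ∀ N, ∑ k ∈ Finset.range N, β ((L ^ k) Q) ≤ β P - β ((L ^ N) P) := fun N => by
    induction N with
    | zero => simp
    | succ N ih =>
      have h1 := hβ _ (hL.pow N _ (qNonneg_of_posDef hR))
      rw [map_sub, map_sub, map_sub, map_sub] at h1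
      rw [Finset.sum_range_succ, pow_succ, Module.End.mul_apply]
      linarith
  refine Real.tsum_le_of_sum_range_le (fun k => hβ _ (hL.pow k _ hQ)) fun N => ?_
  linarith [hbound N, hβ _ (hL.pow N _ (qNonneg_of_posDef hP))]

/-- Geometric decay yields a solution of the strict Lyapunov inequality whose cost is as close to
the series as desired. -/
theorem HasGeomDecay.exists_lyapunov (h : HasGeomDecay L) (hL : IsPositiveMap L)
    (hLs : ∀ P, Pᵀ = P → (L P)ᵀ = L P) (hβ : ∀ P, QNonneg P → 0 ≤ β P)
    (hQ : QNonneg Q) (hQs : Qᵀ = Q) {γ : ℝ} (hγ : ∑' k : ℕ, β ((L ^ k) Q) < γ) :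
    ∃ P : Matrix (Fin n) (Fin n) ℝ, P.PosDef ∧ (P - L P - Q).PosDef ∧ β P < γ := by
  have hLs' : ∀ (k : ℕ) P, Pᵀ = P → ((L ^ k) P)ᵀ = (L ^ k) P := fun k => by
    induction k with
    | zero => intro P hP; simpa using hP
    | succ k ih => intro P hP; rw [pow_succ']; exact hLs _ (ih _ hP)
  have hsQ := h.summable hL hβ hQ
  have hs1 := h.summable hL hβ qNonneg_one
  set S := ∑' k : ℕ, β ((L ^ k) Q)
  set T := ∑' k : ℕ, β ((L ^ k) 1)
  have hT : 0 ≤ T := tsum_nonneg fun k => hβ _ (hL.pow k _ qNonneg_one)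
  -- Perturbing `Q` by `ε 1` costs at most `ε T`, which must fit in the gap `γ - S`. Using `T + 1`
  -- avoids dividing by zero.
  obtain ⟨ε, hε, hεT⟩ : ∃ ε : ℝ, 0 < ε ∧ S + ε * T < γ := by
    refine ⟨(γ - S) / (2 * (T + 1)), div_pos (by linarith) (by linarith), ?_⟩
    have : (γ - S) / (2 * (T + 1)) * T ≤ (γ - S) / 2 := by
      rw [div_mul_eq_mul_div, div_le_div_iff₀ (by linarith) two_pos]
      nlinarith
    linarith
  obtain ⟨a, ρ, ha, hρ, hρ1, hk⟩ := h.exists_bound hL (Q + ε • 1)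
  -- The tail `L^(N+1) E` left by truncation must be smaller than the gain `ε 1`.
  obtain ⟨N, hN⟩ : ∃ N : ℕ, a * ρ ^ (N + 1) < ε := by
    have h1 : Tendsto (fun N : ℕ => a * ρ ^ (N + 1)) atTop (𝓝 (a * 0)) :=
      (((tendsto_pow_atTop_nhds_zero_of_lt_one hρ.le hρ1).comp (tendsto_add_atTop_nat 1))).const_mul a
    rw [mul_zero] at h1
    exact (h1.eventually (gt_mem_nhds hε)).exists
  set E : Matrix (Fin n) (Fin n) ℝ := Q + ε • 1 with hE
  have hEs : Eᵀ = E := by simp [hE, hQs]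
  have hEn : QNonneg E := hQ.add (qNonneg_one.smul hε.le)
  have hxx : ∀ x : Fin n → ℝ, x ≠ 0 → 0 < x ⬝ᵥ x := fun x hx =>
    dotProduct_self_star_pos_iff.2 hx
  -- Truncation gives `P - L P - Q = ε 1 - L^(N+1) E`, positive definite by the choice of `N`; the
  -- `k = 0` term `E ≥ ε 1` makes `P` itself positive definite.
  set P := ∑ k ∈ Finset.range (N + 1), (L ^ k) E with hP
  have hPs : Pᵀ = P := by
    rw [hP, transpose_sum]
    exact Finset.sum_congr rfl fun k _ => hLs' k _ hEs
  have hPL : P - L P = E - (L ^ (N + 1)) E := by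
    have : L P = ∑ k ∈ Finset.range (N + 1), (L ^ (k + 1)) E := by
      rw [hP, map_sum]
      exact Finset.sum_congr rfl fun k _ => by rw [pow_succ', Module.End.mul_apply]
    rw [this, hP, ← Finset.sum_sub_distrib, Finset.sum_range_sub' (fun k => (L ^ k) E)]
    simp
  refine ⟨P, posDef_iff_quad.2 ⟨hPs, fun x hx => ?_⟩, posDef_iff_quad.2 ⟨?_, fun x hx => ?_⟩, ?_⟩
  · rw [hP, quad_sum]
    have h1 : quad ((L ^ 0) E) x ≤ ∑ k ∈ Finset.range (N + 1), quad ((L ^ k) E) x :=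
      Finset.single_le_sum (f := fun k => quad ((L ^ k) E) x)
        (fun k _ => hL.pow k _ hEn x) (by simp)
    refine lt_of_lt_of_le ?_ h1
    simp only [pow_zero, Module.End.one_apply, hE, quad_add, quad_smul, quad_one]
    have := mul_pos hε (hxx x hx)
    linarith [hQ x]
  · rw [transpose_sub, transpose_sub, hPs, hLs _ hPs, hQs]
  · rw [hPL, quad_sub, quad_sub]
    have h1 := hk (N + 1) x
    simp only [hE, quad_add, quad_smul, quad_one] at h1 ⊢
    have := mul_lt_mul_of_pos_right hN (hxx x hx)
    linarith
  · have h1 : β P = ∑ k ∈ Finset.range (N + 1), β ((L ^ k) Q) +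
        ε * ∑ k ∈ Finset.range (N + 1), β ((L ^ k) 1) := by
      simp [hP, hE, Finset.sum_add_distrib, Finset.mul_sum]
    have h2 := hsQ.sum_le_tsum (Finset.range (N + 1)) fun k _ => hβ _ (hL.pow k _ hQ)
    have h3 := hs1.sum_le_tsum (Finset.range (N + 1)) fun k _ => hβ _ (hL.pow k _ qNonneg_one)
    have h4 := mul_le_mul_of_nonneg_left h3 hε.le
    rw [h1]
    linarith

end QuadraticForms

/-! ### Second moments under independence. -/

section SecondMoments

variable {Ω : Type*} [MeasurableSpace Ω] {μ : Measure Ω} {Z n p q r : ℕ}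

/-- All entries of the random matrix `M` are square integrable. -/
def IsL2 {r c : ℕ} (μ : Measure Ω) (M : Ω → Matrix (Fin r) (Fin c) ℝ) : Prop :=
  ∀ i j, MemLp (fun ω => M ω i j) 2 μ

/-- The linear map `P ↦ E[Mᵀ P M]`, written through the second moments of the entries of `M`. -/
noncomputable def lyap (μ : Measure Ω) (M : Ω → Matrix (Fin r) (Fin n) ℝ) :
    Matrix (Fin r) (Fin r) ℝ →ₗ[ℝ] Matrix (Fin n) (Fin n) ℝ where
  toFun P := Matrix.of fun i j => ∑ k, ∑ l, P k l * ∫ ω, M ω k i * M ω l j ∂μ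
  map_add' P R := by
    ext i j
    simp [add_mul, Finset.sum_add_distrib]
  map_smul' c P := by
    ext i j
    simp [mul_assoc, Finset.mul_sum]

theorem lyap_apply (M : Ω → Matrix (Fin r) (Fin n) ℝ) (P : Matrix (Fin r) (Fin r) ℝ)
    (i j : Fin n) :
    lyap μ M P i j = ∑ k, ∑ l, P k l * ∫ ω, M ω k i * M ω l j ∂μ := rfl

theorem lyap_transpose (M : Ω → Matrix (Fin r) (Fin n) ℝ) {P : Matrix (Fin r) (Fin r) ℝ}
    (hP : Pᵀ = P) : (lyap μ M P)ᵀ = lyap μ M P := by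
  ext i j
  rw [transpose_apply, lyap_apply, lyap_apply, Finset.sum_comm]
  refine Finset.sum_congr rfl fun k _ => Finset.sum_congr rfl fun l _ => ?_
  rw [← congrFun (congrFun hP l) k, transpose_apply]
  simp only [mul_comm]

theorem conj_apply (M : Matrix (Fin r) (Fin n) ℝ) (P : Matrix (Fin r) (Fin r) ℝ) (i j : Fin n) :
    (Mᵀ * P * M) i j = ∑ k, ∑ l, P k l * (M k i * M l j) := by
  simp only [mul_apply, transpose_apply, Finset.sum_mul]
  rw [Finset.sum_comm]
  exact Finset.sum_congr rfl fun k _ => Finset.sum_congr rfl fun l _ => by ring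

theorem IsL2.integrable_mul {M : Ω → Matrix (Fin r) (Fin n) ℝ} (hM : IsL2 μ M)
    (k l : Fin r) (i j : Fin n) : Integrable (fun ω => M ω k i * M ω l j) μ :=
  (hM k i).integrable_mul (hM l j)

theorem IsL2.integrable_conj {M : Ω → Matrix (Fin r) (Fin n) ℝ} (hM : IsL2 μ M)
    (P : Matrix (Fin r) (Fin r) ℝ) (i j : Fin n) :
    Integrable (fun ω => ((M ω)ᵀ * P * M ω) i j) μ := by
  simp only [conj_apply]
  exact integrable_finsetSum _ fun k _ => integrable_finsetSum _ fun l _ =>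
    (hM.integrable_mul k l i j).const_mul _

/-- `lyap` is linear unconditionally because it is built from entry moments; square integrability is
what identifies it with the expectation. -/
theorem IsL2.integral_conj {M : Ω → Matrix (Fin r) (Fin n) ℝ} (hM : IsL2 μ M)
    (P : Matrix (Fin r) (Fin r) ℝ) (i j : Fin n) :
    ∫ ω, ((M ω)ᵀ * P * M ω) i j ∂μ = lyap μ M P i j := by
  have h : ∀ k l, Integrable (fun ω => P k l * (M ω k i * M ω l j)) μ := fun k l =>
    (hM.integrable_mul k l i j).const_mul _
  simp only [conj_apply, lyap_apply]
  rw [integral_finsetSum _ fun k _ => integrable_finsetSum _ fun l _ => h k l]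
  refine Finset.sum_congr rfl fun k _ => ?_
  rw [integral_finsetSum _ fun l _ => h k l]
  exact Finset.sum_congr rfl fun l _ => integral_const_mul _ _

theorem IsL2.integrable_trace {M : Ω → Matrix (Fin r) (Fin n) ℝ} (hM : IsL2 μ M)
    (P : Matrix (Fin r) (Fin r) ℝ) : Integrable (fun ω => ((M ω)ᵀ * P * M ω).trace) μ := by
  simp only [trace, diag_apply]
  exact integrable_finsetSum _ fun i _ => hM.integrable_conj P i i

theorem IsL2.integral_trace {M : Ω → Matrix (Fin r) (Fin n) ℝ} (hM : IsL2 μ M)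
    (P : Matrix (Fin r) (Fin r) ℝ) :
    ∫ ω, ((M ω)ᵀ * P * M ω).trace ∂μ = (lyap μ M P).trace := by
  simp only [trace, diag_apply]
  rw [integral_finsetSum _ fun i _ => hM.integrable_conj P i i]
  exact Finset.sum_congr rfl fun i _ => hM.integral_conj P i i

theorem integrable_quad {X : Ω → Fin n → ℝ} (hX : ∀ i, MemLp (fun ω => X ω i) 2 μ)
    (P : Matrix (Fin n) (Fin n) ℝ) : Integrable (fun ω => quad P (X ω)) μ := by
  simp only [quad_eq_sum]
  exact integrable_finsetSum _ fun i _ => integrable_finsetSum _ fun j _ =>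
    ((hX i).integrable_mul (hX j)).const_mul _

theorem integral_quad {X : Ω → Fin n → ℝ} (hX : ∀ i, MemLp (fun ω => X ω i) 2 μ)
    (P : Matrix (Fin n) (Fin n) ℝ) :
    ∫ ω, quad P (X ω) ∂μ = ∑ i, ∑ j, P i j * ∫ ω, X ω i * X ω j ∂μ := by
  have h : ∀ i j, Integrable (fun ω => P i j * (X ω i * X ω j)) μ := fun i j =>
    ((hX i).integrable_mul (hX j)).const_mul _
  simp only [quad_eq_sum]
  rw [integral_finsetSum _ fun i _ => integrable_finsetSum _ fun j _ => h i j]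
  refine Finset.sum_congr rfl fun i _ => ?_
  rw [integral_finsetSum _ fun j _ => h i j]
  exact Finset.sum_congr rfl fun j _ => integral_const_mul _ _

section Indep

variable {Ω : Type*} {m₁ m₂ : MeasurableSpace Ω} [MeasurableSpace Ω] {μ : Measure Ω}
  {M : Ω → Matrix (Fin r) (Fin n) ℝ} {X : Ω → Fin n → ℝ}

theorem indepFun_of_indep {f g : Ω → ℝ} (h : Indep m₁ m₂ μ) (hf : Measurable[m₁] f)
    (hg : Measurable[m₂] g) : IndepFun f g μ :=
  indep_of_indep_of_le_left (indep_of_indep_of_le_right h hg.comap_le) hf.comap_le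

/-- A product of two square integrable variables is in general only integrable; here the squares are
independent, so the product is again square integrable. -/
theorem memLp_mulVec_of_indep (h : Indep m₁ m₂ μ)
    (hM : ∀ i j, Measurable[m₁] fun ω => M ω i j) (hM2 : IsL2 μ M)
    (hX : ∀ i, Measurable[m₂] fun ω => X ω i) (hX2 : ∀ i, MemLp (fun ω => X ω i) 2 μ)
    (i : Fin r) : MemLp (fun ω => (M ω *ᵥ X ω) i) 2 μ := by
  simp only [mulVec, dotProduct]
  refine memLp_finsetSum _ fun j _ => ?_
  refine (memLp_two_iff_integrable_sq (f := fun ω => M ω i j * X ω j)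
    ((hM2 i j).1.mul (hX2 j).1)).2 ?_
  simp only [mul_pow]
  exact (indepFun_of_indep h ((hM i j).pow_const 2) ((hX j).pow_const 2)).integrable_mul
    (hM2 i j).integrable_sq (hX2 j).integrable_sq

/-- The entries of `Mᵀ P M` are independent of the products `X i * X j`, so each expectation
factors. -/
theorem integral_quad_mulVec_of_indep (h : Indep m₁ m₂ μ)
    (hM : ∀ i j, Measurable[m₁] fun ω => M ω i j) (hM2 : IsL2 μ M)
    (hX : ∀ i, Measurable[m₂] fun ω => X ω i) (hX2 : ∀ i, MemLp (fun ω => X ω i) 2 μ)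
    (P : Matrix (Fin r) (Fin r) ℝ) :
    ∫ ω, quad P (M ω *ᵥ X ω) ∂μ = ∫ ω, quad (lyap μ M P) (X ω) ∂μ := by
  have hmeas : ∀ i j, Measurable[m₁] fun ω => ((M ω)ᵀ * P * M ω) i j := fun i j => by
    simp only [conj_apply]
    exact Finset.measurable_sum _ fun k _ => Finset.measurable_sum _ fun l _ =>
      ((hM k i).mul (hM l j)).const_mul _
  have hind : ∀ i j, IndepFun (fun ω => ((M ω)ᵀ * P * M ω) i j) (fun ω => X ω i * X ω j) μ :=
    fun i j => indepFun_of_indep h (hmeas i j) ((hX i).mul (hX j))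
  have hXX : ∀ i j, Integrable (fun ω => X ω i * X ω j) μ := fun i j =>
    (hX2 i).integrable_mul (hX2 j)
  have hint : ∀ i j, Integrable (fun ω => ((M ω)ᵀ * P * M ω) i j * (X ω i * X ω j)) μ :=
    fun i j => (hind i j).integrable_mul (hM2.integrable_conj P i j) (hXX i j)
  rw [integral_quad hX2]
  simp only [quad_mulVec]
  simp only [quad_eq_sum]
  rw [integral_finsetSum _ fun i _ => integrable_finsetSum _ fun j _ => hint i j]
  refine Finset.sum_congr rfl fun i _ => ?_
  rw [integral_finsetSum _ fun j _ => hint i j]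
  refine Finset.sum_congr rfl fun j _ => ?_
  rw [(hind i j).integral_fun_mul_eq_mul_integral (hM2.integrable_conj P i j).1 (hXX i j).1,
    hM2.integral_conj]

end Indep

section Const

variable [IsProbabilityMeasure μ] {M : Ω → Matrix (Fin r) (Fin n) ℝ}

theorem quad_lyap (hM : ∀ i j, Measurable fun ω => M ω i j) (hM2 : IsL2 μ M)
    (P : Matrix (Fin r) (Fin r) ℝ) (x : Fin n → ℝ) :
    quad (lyap μ M P) x = ∫ ω, quad P (M ω *ᵥ x) ∂μ := by
  -- A constant vector is measurable for the trivial σ-algebra, which is independent of everything.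
  rw [integral_quad_mulVec_of_indep (indep_bot_right _) (X := fun _ => x) hM hM2
    (fun i => measurable_const) (fun i => memLp_const _)]
  simp

theorem qNonneg_lyap (hM : ∀ i j, Measurable fun ω => M ω i j) (hM2 : IsL2 μ M)
    {P : Matrix (Fin r) (Fin r) ℝ} (hP : QNonneg P) : QNonneg (lyap μ M P) := fun x => by
  rw [quad_lyap hM hM2]
  exact integral_nonneg fun ω => hP _

theorem QNonneg.trace_nonneg {P : Matrix (Fin n) (Fin n) ℝ} (hP : QNonneg P) : 0 ≤ P.trace :=
  Finset.sum_nonneg fun i _ => by simpa [quad] using hP (Pi.single i 1)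

theorem trace_eq_sum_quad (P : Matrix (Fin n) (Fin n) ℝ) :
    P.trace = ∑ i, quad P (Pi.single i 1) := by
  simp [quad, trace]

end Const

/-- The information carried by `ξ_0, …, ξ_{k-1}`. -/
@[reducible]
def past {Ω : Type*} (ξ : ℕ → Ω → EuclideanSpace ℝ (Fin Z)) (k : ℕ) : MeasurableSpace Ω :=
  ⨆ i ∈ Set.Iio k, MeasurableSpace.comap (ξ i) inferInstance

theorem past_mono {Ω : Type*} {ξ : ℕ → Ω → EuclideanSpace ℝ (Fin Z)} {j k : ℕ} (h : j ≤ k) : past ξ j ≤ past ξ k :=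
  biSup_mono fun _ hi => lt_of_lt_of_le hi h

theorem comap_le_past {Ω : Type*} {ξ : ℕ → Ω → EuclideanSpace ℝ (Fin Z)} {j k : ℕ} (h : j < k) :
    MeasurableSpace.comap (ξ j) inferInstance ≤ past ξ k :=
  le_biSup (fun i => MeasurableSpace.comap (ξ i) inferInstance) (Set.mem_Iio.2 h)

theorem measurable_entry_comap {Ω : Type*} {ξ : ℕ → Ω → EuclideanSpace ℝ (Fin Z)}
    {M : EuclideanSpace ℝ (Fin Z) → Matrix (Fin r) (Fin n) ℝ}
    (hM : ∀ i j, Measurable fun z => M z i j) (k : ℕ) (i : Fin r) (j : Fin n) :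
    Measurable[MeasurableSpace.comap (ξ k) inferInstance] fun ω => M (ξ k ω) i j :=
  (hM i j).comp (comap_measurable (ξ k))

section Past

variable {ξ : ℕ → Ω → EuclideanSpace ℝ (Fin Z)}

theorem IsIID.indep_past (hξ : IsIID μ ξ) (k : ℕ) :
    Indep (MeasurableSpace.comap (ξ k) inferInstance) (past ξ k) μ := by
  have h := indep_iSup_of_disjoint (m := fun i => MeasurableSpace.comap (ξ i) inferInstance)
    (fun i => (hξ.measurable i).comap_le) hξ.indep (S := {k}) (T := Set.Iio k) (by simp)
  simpa [past] using h

/-- Equal laws have equal second moments, so a single map governs all times. -/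
theorem IsIID.lyap_eq (hξ : IsIID μ ξ)
    {M : EuclideanSpace ℝ (Fin Z) → Matrix (Fin r) (Fin n) ℝ}
    (hM : ∀ i j, Measurable fun z => M z i j) (k : ℕ) :
    lyap μ (fun ω => M (ξ k ω)) = lyap μ (fun ω => M (ξ 0 ω)) := by
  ext P i j
  simp only [lyap_apply]
  refine Finset.sum_congr rfl fun s _ => Finset.sum_congr rfl fun t _ => ?_
  congr 1
  exact ((hξ.ident k).comp ((hM s i).mul (hM t j))).integral_eq

theorem IsIID.isL2 (hξ : IsIID μ ξ)
    {M : EuclideanSpace ℝ (Fin Z) → Matrix (Fin r) (Fin n) ℝ}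
    (hM : ∀ i j, Measurable fun z => M z i j) (hM2 : HasSqIntegrableEntries μ ξ M) (k : ℕ) :
    IsL2 μ (fun ω => M (ξ k ω)) := fun i j => by
  have h0 : MemLp (fun ω => M (ξ 0 ω) i j) 2 μ :=
    (memLp_two_iff_integrable_sq
      ((hM i j).comp (hξ.measurable 0)).aestronglyMeasurable).2 (hM2 i j)
  exact ((hξ.ident k).comp (hM i j)).memLp_iff.2 h0

/-- A zero-input trajectory that starts at time `j` from a square integrable vector depending on
the past only stays square integrable, depends on the past only, and its second moments are
propagated by the map `P ↦ E[Aᵀ P A]`. -/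
theorem IsIID.trajectory (hξ : IsIID μ ξ)
    {A : EuclideanSpace ℝ (Fin Z) → Matrix (Fin n) (Fin n) ℝ}
    (hA : ∀ i j, Measurable fun z => A z i j) (hA2 : HasSqIntegrableEntries μ ξ A)
    {j : ℕ} {X : ℕ → Ω → Fin n → ℝ} (hX0 : ∀ i, Measurable[past ξ j] fun ω => X 0 ω i)
    (hX2 : ∀ i, MemLp (fun ω => X 0 ω i) 2 μ)
    (hX : ∀ k ω, X (k + 1) ω = A (ξ (j + k) ω) *ᵥ X k ω) (k : ℕ) :
    (∀ i, Measurable[past ξ (j + k)] fun ω => X k ω i) ∧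
    (∀ i, MemLp (fun ω => X k ω i) 2 μ) ∧
    ∀ P, ∫ ω, quad P (X k ω) ∂μ =
      ∫ ω, quad ((lyap μ (fun ω => A (ξ 0 ω)) ^ k) P) (X 0 ω) ∂μ := by
  induction k with
  | zero => exact ⟨hX0, hX2, fun P => by simp⟩
  | succ k ih =>
    obtain ⟨h1, h2, h3⟩ := ih
    have hAk := measurable_entry_comap (ξ := ξ) hA (j + k)
    have hAk2 := hξ.isL2 hA hA2 (j + k)
    have hind := hξ.indep_past (j + k)
    simp only [hX]
    refine ⟨fun i => ?_, memLp_mulVec_of_indep hind hAk hAk2 h1 h2, fun P => ?_⟩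
    · simp only [mulVec, dotProduct]
      refine Finset.measurable_sum _ fun l _ => ?_
      exact ((hAk i l).mono (comap_le_past (by omega)) le_rfl).mul
        ((h1 l).mono (past_mono (by omega)) le_rfl)
    -- Averaging out the newest factor turns `P` into `L P` on the earlier state, so the new `L` is
    -- the innermost one.
    · rw [integral_quad_mulVec_of_indep hind hAk hAk2 h1 h2, hξ.lyap_eq hA, h3, pow_succ,
        Module.End.mul_apply]

end Past

end SecondMoments

/-! ### Stability and the impulse response in terms of the moment maps. -/

section H2

theorem euclNorm_sq {m : ℕ} (v : Fin m → ℝ) : euclNorm v ^ 2 = quad 1 v := by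
  rw [euclNorm, EuclideanSpace.real_norm_sq_eq, quad_one]
  simp [dotProduct, sq]

variable {Ω : Type*} [MeasurableSpace Ω] {μ : Measure Ω} {Z n p q : ℕ}
  {ξ : ℕ → Ω → EuclideanSpace ℝ (Fin Z)} {G : System Z n p q}

/-- The coefficients are Borel functions on the whole space and the squares of the entries of
their values at `ξ_0` are integrable. -/
structure System.IsGlobal (G : System Z n p q) (μ : Measure Ω)
    (ξ : ℕ → Ω → EuclideanSpace ℝ (Fin Z)) : Prop where
  meas_A : ∀ i j, Measurable fun z => G.A z i j
  meas_B : ∀ i j, Measurable fun z => G.B z i j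
  meas_C : ∀ i j, Measurable fun z => G.C z i j
  meas_D : ∀ i j, Measurable fun z => G.D z i j
  sq_A : HasSqIntegrableEntries μ ξ G.A
  sq_B : HasSqIntegrableEntries μ ξ G.B
  sq_C : HasSqIntegrableEntries μ ξ G.C
  sq_D : HasSqIntegrableEntries μ ξ G.D

/-- The map `P ↦ E[A(ξ_0)ᵀ P A(ξ_0)]`. -/
noncomputable def System.stateMap (G : System Z n p q) (μ : Measure Ω)
    (ξ : ℕ → Ω → EuclideanSpace ℝ (Fin Z)) :
    Matrix (Fin n) (Fin n) ℝ →ₗ[ℝ] Matrix (Fin n) (Fin n) ℝ :=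
  lyap μ fun ω => G.A (ξ 0 ω)

/-- The matrix `E[C(ξ_0)ᵀ C(ξ_0)]`. -/
noncomputable def System.outputGram (G : System Z n p q) (μ : Measure Ω)
    (ξ : ℕ → Ω → EuclideanSpace ℝ (Fin Z)) : Matrix (Fin n) (Fin n) ℝ :=
  lyap μ (fun ω => G.C (ξ 0 ω)) 1

/-- The functional `P ↦ E[tr(B(ξ_0)ᵀ P B(ξ_0))]`. -/
noncomputable def System.inputCost (G : System Z n p q) (μ : Measure Ω)
    (ξ : ℕ → Ω → EuclideanSpace ℝ (Fin Z)) : Matrix (Fin n) (Fin n) ℝ →ₗ[ℝ] ℝ :=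
  (traceLinearMap (Fin p) ℝ ℝ).comp (lyap μ fun ω => G.B (ξ 0 ω))

theorem System.inputCost_apply (P : Matrix (Fin n) (Fin n) ℝ) :
    G.inputCost μ ξ P = (lyap μ (fun ω => G.B (ξ 0 ω)) P).trace := rfl

section Global

variable [IsProbabilityMeasure μ] (hξ : IsIID μ ξ) (hG : G.IsGlobal μ ξ)
include hξ hG

theorem System.stateMap_positive : IsPositiveMap (G.stateMap μ ξ) := fun _ hP =>
  qNonneg_lyap (fun i j => (hG.meas_A i j).comp (hξ.measurable 0))
    (hξ.isL2 hG.meas_A hG.sq_A 0) hP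

theorem System.outputGram_qNonneg : QNonneg (G.outputGram μ ξ) :=
  qNonneg_lyap (fun i j => (hG.meas_C i j).comp (hξ.measurable 0))
    (hξ.isL2 hG.meas_C hG.sq_C 0) qNonneg_one

theorem System.inputCost_nonneg (P : Matrix (Fin n) (Fin n) ℝ) (hP : QNonneg P) :
    0 ≤ G.inputCost μ ξ P :=
  (qNonneg_lyap (fun i j => (hG.meas_B i j).comp (hξ.measurable 0))
    (hξ.isL2 hG.meas_B hG.sq_B 0) hP).trace_nonneg

theorem System.second_moment_state (k : ℕ) (x₀ : Fin n → ℝ) :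
    Integrable (fun ω => euclNorm (G.state ξ 0 x₀ k ω) ^ 2) μ ∧
    ∫ ω, euclNorm (G.state ξ 0 x₀ k ω) ^ 2 ∂μ = quad ((G.stateMap μ ξ ^ k) 1) x₀ := by
  obtain ⟨-, h2, h3⟩ := hξ.trajectory hG.meas_A hG.sq_A (j := 0)
    (X := fun k ω => G.state ξ 0 x₀ k ω) (fun i => measurable_const) (fun i => memLp_const _)
    (fun k ω => by simp [System.state]) k
  simp only [euclNorm_sq]
  refine ⟨integrable_quad h2 1, ?_⟩
  rw [h3 1]
  simp [System.state, System.stateMap]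

/-- The second moment of the state is exactly `quad ((L ^ k) 1) x₀`, so the two sets of constants
correspond by squaring and taking square roots. -/
theorem System.isExpStable_iff : G.IsExpStable μ ξ ↔ HasGeomDecay (G.stateMap μ ξ) := by
  constructor
  · rintro ⟨a, l, ha, hl, hl1, h⟩
    refine ⟨a ^ 2, l ^ 2, by positivity, by positivity, by nlinarith, fun k x => ?_⟩
    have h1 := (Real.sqrt_le_iff.1 (h k x).2).2
    rw [(System.second_moment_state hξ hG k x).2, mul_pow, mul_pow, euclNorm_sq, quad_one] at h1
    refine h1.trans_eq ?_
    ring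
  · rintro ⟨a, ρ, ha, hρ, hρ1, h⟩
    refine ⟨√a, √ρ, Real.sqrt_pos.2 ha, Real.sqrt_pos.2 hρ,
      by rw [Real.sqrt_lt' one_pos]; simpa using hρ1, fun k x => ?_⟩
    obtain ⟨h1, h2⟩ := System.second_moment_state hξ hG k x
    refine ⟨h1, Real.sqrt_le_iff.2 ⟨?_, ?_⟩⟩
    · exact mul_nonneg (mul_nonneg (Real.sqrt_nonneg _) (norm_nonneg _))
        (pow_nonneg (Real.sqrt_nonneg _) _)
    · rw [h2, mul_pow, mul_pow, euclNorm_sq, quad_one, ← pow_mul, mul_comm k, pow_mul,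
        Real.sq_sqrt ha.le, Real.sq_sqrt hρ.le]
      refine (h k x).trans_eq ?_
      ring

/-- The trace is a sum over input directions. Column `j` of the transition matrix times `B(ξ_0)` is
a zero-input trajectory started at time 1 from `B(ξ_0) e_j`, which depends on `ξ_0` only. At time `1
+ k` it has absorbed `k` factors `A`. -/
theorem System.integral_impulse_term (k : ℕ) :
    ∫ ω, ((G.B (ξ 0 ω))ᵀ * (G.transition ξ 1 (1 + k) ω)ᵀ * (G.C (ξ (1 + k) ω))ᵀ *
      G.C (ξ (1 + k) ω) * G.transition ξ 1 (1 + k) ω * G.B (ξ 0 ω)).trace ∂μ =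
    G.inputCost μ ξ ((G.stateMap μ ξ ^ k) (G.outputGram μ ξ)) := by
  let X : Fin p → ℕ → Ω → Fin n → ℝ := fun j k ω =>
    G.transition ξ 1 (1 + k) ω *ᵥ (G.B (ξ 0 ω) *ᵥ Pi.single j 1)
  have hX0 : ∀ j ω, X j 0 ω = G.B (ξ 0 ω) *ᵥ Pi.single j 1 := fun j ω => by
    simp [X, System.transition_self]
  have hB2 := hξ.isL2 hG.meas_B hG.sq_B 0
  have htraj := fun j => hξ.trajectory hG.meas_A hG.sq_A (j := 1) (X := X j)
    (fun i => by
      simp only [hX0, mulVec_single_one, col_apply]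
      exact (measurable_entry_comap hG.meas_B 0 i j).mono (comap_le_past one_pos) le_rfl)
    (fun i => by
      simp only [hX0, mulVec_single_one, col_apply]
      exact hB2 i j)
    (fun k ω => by
      simp only [X]
      rw [← add_assoc, System.transition_succ G ξ (by omega), ← mulVec_mulVec]) k
  have hCk := measurable_entry_comap (ξ := ξ) hG.meas_C (1 + k)
  have hCk2 := hξ.isL2 hG.meas_C hG.sq_C (1 + k)
  have htr : ∀ ω, ((G.B (ξ 0 ω))ᵀ * (G.transition ξ 1 (1 + k) ω)ᵀ * (G.C (ξ (1 + k) ω))ᵀ *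
      G.C (ξ (1 + k) ω) * G.transition ξ 1 (1 + k) ω * G.B (ξ 0 ω)).trace =
      ∑ j, quad 1 (G.C (ξ (1 + k) ω) *ᵥ X j k ω) := fun ω => by
    rw [trace_eq_sum_quad]
    refine Finset.sum_congr rfl fun j _ => ?_
    simp only [X, quad_mulVec]
    simp only [Matrix.mul_assoc, Matrix.mul_one]
  simp only [htr]
  rw [integral_finsetSum _ fun j _ => integrable_quad
    (memLp_mulVec_of_indep (hξ.indep_past (1 + k)) hCk hCk2 (htraj j).1 (htraj j).2.1) 1,
    System.inputCost_apply, trace_eq_sum_quad]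
  refine Finset.sum_congr rfl fun j _ => ?_
  -- The factors are averaged out from newest to oldest: `C(ξ_{1+k})`, then the `A` factors, then
  -- `B(ξ_0)`.
  rw [integral_quad_mulVec_of_indep (hξ.indep_past (1 + k)) hCk hCk2 (htraj j).1 (htraj j).2.1,
    hξ.lyap_eq hG.meas_C, (htraj j).2.2,
    quad_lyap (M := fun ω => G.B (ξ 0 ω))
      (fun i j => (hG.meas_B i j).comp (hξ.measurable 0)) hB2]
  simp only [hX0]
  rfl

theorem System.impulseSum_eq (K : ℕ) :
    G.impulseSum μ ξ K = (∫ ω, ((G.D (ξ 0 ω))ᵀ * G.D (ξ 0 ω)).trace ∂μ) +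
      ∑ k ∈ Finset.range K, G.inputCost μ ξ ((G.stateMap μ ξ ^ k) (G.outputGram μ ξ)) := by
  rw [System.impulseSum, ← Finset.Ico_add_one_right_eq_Icc, Finset.sum_Ico_eq_sum_range]
  congr 1
  exact Finset.sum_congr rfl fun k _ => System.integral_impulse_term hξ hG k

theorem System.tendsto_impulseSum (h : HasGeomDecay (G.stateMap μ ξ)) :
    Tendsto (G.impulseSum μ ξ) atTop (𝓝 ((∫ ω, ((G.D (ξ 0 ω))ᵀ * G.D (ξ 0 ω)).trace ∂μ) +
      ∑' k : ℕ, G.inputCost μ ξ ((G.stateMap μ ξ ^ k) (G.outputGram μ ξ)))) := by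
  have h1 := h.summable (System.stateMap_positive hξ hG) (System.inputCost_nonneg hξ hG)
    (System.outputGram_qNonneg hξ hG)
  have h2 := h1.hasSum.tendsto_sum_nat.const_add
    (∫ ω, ((G.D (ξ 0 ω))ᵀ * G.D (ξ 0 ω)).trace ∂μ)
  exact h2.congr fun K => (System.impulseSum_eq hξ hG K).symm

theorem System.matExp_lyapunov (P : Matrix (Fin n) (Fin n) ℝ) :
    (matExp μ fun ω =>
      P - (G.A (ξ 0 ω))ᵀ * P * G.A (ξ 0 ω) - (G.C (ξ 0 ω))ᵀ * G.C (ξ 0 ω)) =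
    P - G.stateMap μ ξ P - G.outputGram μ ξ := by
  have hA2 := hξ.isL2 hG.meas_A hG.sq_A 0
  have hC2 := hξ.isL2 hG.meas_C hG.sq_C 0
  ext i j
  have h1 := hA2.integrable_conj P i j
  have h2 := hC2.integrable_conj 1 i j
  have h3 := hC2.integral_conj 1 i j
  simp only [Matrix.mul_one] at h2 h3
  simp only [matExp, of_apply, Matrix.sub_apply]
  have h4 : Integrable (fun ω => P i j - ((G.A (ξ 0 ω))ᵀ * P * G.A (ξ 0 ω)) i j) μ :=
    (integrable_const _).sub h1
  rw [integral_sub h4 h2, integral_sub (integrable_const _) h1, hA2.integral_conj, h3]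
  simp [System.stateMap, System.outputGram]

omit [IsProbabilityMeasure μ] in
theorem System.integral_cost (P : Matrix (Fin n) (Fin n) ℝ) :
    ∫ ω, ((G.D (ξ 0 ω))ᵀ * G.D (ξ 0 ω) + (G.B (ξ 0 ω))ᵀ * P * G.B (ξ 0 ω)).trace ∂μ =
    (∫ ω, ((G.D (ξ 0 ω))ᵀ * G.D (ξ 0 ω)).trace ∂μ) + G.inputCost μ ξ P := by
  have hB2 := hξ.isL2 hG.meas_B hG.sq_B 0
  have h1 := (hξ.isL2 hG.meas_D hG.sq_D 0).integrable_trace 1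
  simp only [Matrix.mul_one] at h1
  simp only [trace_add]
  rw [integral_add h1 (hB2.integrable_trace P), hB2.integral_trace, System.inputCost_apply]

/-- The characterization of the `H₂` norm for coefficients that are Borel on the whole space. -/
theorem System.h2_characterization_of_isGlobal {γ : ℝ} (hγ : 0 < γ) :
    (G.IsExpStable μ ξ → ∃ s : ℝ, Tendsto (G.impulseSum μ ξ) atTop (𝓝 s)) ∧
    ((G.IsExpStable μ ξ ∧ G.h2Norm μ ξ < γ) ↔
      ∃ P : Matrix (Fin n) (Fin n) ℝ, P.PosDef ∧
        (matExp μ fun ω =>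
          P - (G.A (ξ 0 ω))ᵀ * P * G.A (ξ 0 ω) - (G.C (ξ 0 ω))ᵀ * G.C (ξ 0 ω)).PosDef ∧
        ∫ ω, ((G.D (ξ 0 ω))ᵀ * G.D (ξ 0 ω) + (G.B (ξ 0 ω))ᵀ * P * G.B (ξ 0 ω)).trace ∂μ
          < γ ^ 2) := by
  have hL := System.stateMap_positive hξ hG
  have hβ := System.inputCost_nonneg hξ hG
  have hQ := System.outputGram_qNonneg hξ hG
  rw [System.isExpStable_iff hξ hG]
  simp only [System.matExp_lyapunov hξ hG, System.integral_cost hξ hG]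
  refine ⟨fun h => ⟨_, System.tendsto_impulseSum hξ hG h⟩, ?_, ?_⟩
  · rintro ⟨h, hlt⟩
    -- Convergence gives `limUnder` its value, and the bound left for the series is `γ²` minus the
    -- contribution of `D`.
    rw [System.h2Norm, (System.tendsto_impulseSum hξ hG h).limUnder_eq, Real.sqrt_lt' hγ] at hlt
    obtain ⟨P, h1, h2, h3⟩ := h.exists_lyapunov hL (fun P hP => lyap_transpose _ hP) hβ hQ
      (lyap_transpose _ transpose_one) (lt_sub_iff_add_lt'.2 hlt)
    exact ⟨P, h1, h2, lt_sub_iff_add_lt'.1 h3⟩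
  · rintro ⟨P, h1, h2, h3⟩
    -- Stability has to come first, since the norm is a limit whose existence relies on it.
    have h := hasGeomDecay_of_lyapunov hL hQ h1 h2
    refine ⟨h, ?_⟩
    rw [System.h2Norm, (System.tendsto_impulseSum hξ hG h).limUnder_eq, Real.sqrt_lt' hγ]
    linarith [tsum_le_of_lyapunov hL hβ hQ h1 h2]

end Global

/-! ### Reduction to coefficients that are Borel on the whole space. -/

section Extension

open Classical in
/-- The extension of a matrix-valued function on the support of `ξ_0` by zero. -/
noncomputable def extendZero (μ : Measure Ω) (ξ : ℕ → Ω → EuclideanSpace ℝ (Fin Z)) {r c : ℕ}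
    (M : EuclideanSpace ℝ (Fin Z) → Matrix (Fin r) (Fin c) ℝ) :
    EuclideanSpace ℝ (Fin Z) → Matrix (Fin r) (Fin c) ℝ :=
  fun z => if z ∈ supp μ ξ then M z else 0

theorem extendZero_of_mem {r c : ℕ} {M : EuclideanSpace ℝ (Fin Z) → Matrix (Fin r) (Fin c) ℝ}
    {z : EuclideanSpace ℝ (Fin Z)} (hz : z ∈ supp μ ξ) : extendZero μ ξ M z = M z :=
  if_pos hz

/-- The support is closed, hence Borel, so measurability can be checked separately on it and on its
complement. -/
theorem IsBorelOnSupp.measurable_extendZero {r c : ℕ}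
    {M : EuclideanSpace ℝ (Fin Z) → Matrix (Fin r) (Fin c) ℝ} (hM : IsBorelOnSupp μ ξ M)
    (i : Fin r) (j : Fin c) : Measurable fun z => extendZero μ ξ M z i j := by
  refine measurable_of_restrict_of_restrict_compl
    (s := supp μ ξ) Measure.isClosed_support.measurableSet ?_ ?_
  · convert hM i j using 2 with s
    simp [extendZero_of_mem s.2]
  · convert measurable_const (a := (0 : ℝ)) using 2 with s
    have : (s : EuclideanSpace ℝ (Fin Z)) ∉ supp μ ξ := s.2
    simp [extendZero, this]

/-- The support carries the full mass of the common law, and countably many null events can be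
discarded at once. -/
theorem IsIID.ae_mem_supp (hξ : IsIID μ ξ) : ∀ᵐ ω ∂μ, ∀ k, ξ k ω ∈ supp μ ξ := by
  rw [ae_all_iff]
  intro k
  have h : ∀ᵐ z ∂(μ.map (ξ k)), z ∈ supp μ ξ := by
    rw [(hξ.ident k).map_eq]
    exact Measure.support_mem_ae
  exact ae_of_ae_map (hξ.measurable k).aemeasurable h

/-- The system whose coefficients are those of `G` on the support of `ξ_0` and zero elsewhere. -/
noncomputable def System.extend (G : System Z n p q) (μ : Measure Ω)
    (ξ : ℕ → Ω → EuclideanSpace ℝ (Fin Z)) : System Z n p q where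
  A := extendZero μ ξ G.A
  B := extendZero μ ξ G.B
  C := extendZero μ ξ G.C
  D := extendZero μ ξ G.D

theorem HasSqIntegrableEntries.extendZero (hξ : IsIID μ ξ) {r c : ℕ}
    {M : EuclideanSpace ℝ (Fin Z) → Matrix (Fin r) (Fin c) ℝ}
    (hM : HasSqIntegrableEntries μ ξ M) :
    HasSqIntegrableEntries μ ξ (H2Stoch.extendZero μ ξ M) := fun i j =>
  (hM i j).congr <| hξ.ae_mem_supp.mono fun ω h => by simp only [extendZero_of_mem (h 0)]

theorem System.IsSqIntegrable.isGlobal_extend (hG : G.IsSqIntegrable μ ξ) (hξ : IsIID μ ξ) :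
    (G.extend μ ξ).IsGlobal μ ξ where
  meas_A := hG.borel_A.measurable_extendZero
  meas_B := hG.borel_B.measurable_extendZero
  meas_C := hG.borel_C.measurable_extendZero
  meas_D := hG.borel_D.measurable_extendZero
  sq_A := hG.sq_A.extendZero hξ
  sq_B := hG.sq_B.extendZero hξ
  sq_C := hG.sq_C.extendZero hξ
  sq_D := hG.sq_D.extendZero hξ

section Pointwise

variable {ω : Ω} (h : ∀ k, ξ k ω ∈ supp μ ξ) (k : ℕ)
include h

theorem System.extend_A : (G.extend μ ξ).A (ξ k ω) = G.A (ξ k ω) := extendZero_of_mem (h k)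

theorem System.extend_B : (G.extend μ ξ).B (ξ k ω) = G.B (ξ k ω) := extendZero_of_mem (h k)

theorem System.extend_C : (G.extend μ ξ).C (ξ k ω) = G.C (ξ k ω) := extendZero_of_mem (h k)

theorem System.extend_D : (G.extend μ ξ).D (ξ k ω) = G.D (ξ k ω) := extendZero_of_mem (h k)

theorem System.extend_state (w : ℕ → Ω → Fin p → ℝ) (x₀ : Fin n → ℝ) :
    (G.extend μ ξ).state ξ w x₀ k ω = G.state ξ w x₀ k ω := by
  induction k with
  | zero => rfl
  | succ k ih => simp only [System.state, ih, System.extend_A h, System.extend_B h]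

theorem System.extend_transition (j : ℕ) :
    (G.extend μ ξ).transition ξ j k ω = G.transition ξ j k ω := by
  induction k with
  | zero => rfl
  | succ k ih => simp only [System.transition, ih, System.extend_A h]

end Pointwise

variable (hξ : IsIID μ ξ)
include hξ

theorem System.extend_isExpStable : (G.extend μ ξ).IsExpStable μ ξ ↔ G.IsExpStable μ ξ := by
  have h : ∀ k x₀, (fun ω => euclNorm ((G.extend μ ξ).state ξ 0 x₀ k ω) ^ 2) =ᵐ[μ]
      fun ω => euclNorm (G.state ξ 0 x₀ k ω) ^ 2 := fun k x₀ =>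
    hξ.ae_mem_supp.mono fun ω hω => by simp only [System.extend_state hω]
  unfold System.IsExpStable
  refine exists_congr fun a => exists_congr fun l => and_congr_right' <| and_congr_right' <|
    and_congr_right' <| forall_congr' fun k => forall_congr' fun x₀ => ?_
  rw [integrable_congr (h k x₀), integral_congr_ae (h k x₀)]

theorem System.extend_impulseSum : (G.extend μ ξ).impulseSum μ ξ = G.impulseSum μ ξ := by
  ext K
  unfold System.impulseSum
  refine congrArg₂ (· + ·) (integral_congr_ae ?_)
    (Finset.sum_congr rfl fun k _ => integral_congr_ae ?_)
  · filter_upwards [hξ.ae_mem_supp] with ω hω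
    rw [System.extend_D hω]
  · filter_upwards [hξ.ae_mem_supp] with ω hω
    rw [System.extend_B hω, System.extend_C hω, System.extend_transition hω]

theorem System.extend_matExp (P : Matrix (Fin n) (Fin n) ℝ) :
    (matExp μ fun ω => P - ((G.extend μ ξ).A (ξ 0 ω))ᵀ * P * (G.extend μ ξ).A (ξ 0 ω) -
      ((G.extend μ ξ).C (ξ 0 ω))ᵀ * (G.extend μ ξ).C (ξ 0 ω)) =
    matExp μ fun ω => P - (G.A (ξ 0 ω))ᵀ * P * G.A (ξ 0 ω) - (G.C (ξ 0 ω))ᵀ * G.C (ξ 0 ω) := by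
  ext i j
  exact integral_congr_ae (hξ.ae_mem_supp.mono fun ω hω => by
    simp only [System.extend_A hω, System.extend_C hω])

theorem System.extend_cost (P : Matrix (Fin n) (Fin n) ℝ) :
    ∫ ω, (((G.extend μ ξ).D (ξ 0 ω))ᵀ * (G.extend μ ξ).D (ξ 0 ω) +
      ((G.extend μ ξ).B (ξ 0 ω))ᵀ * P * (G.extend μ ξ).B (ξ 0 ω)).trace ∂μ =
    ∫ ω, ((G.D (ξ 0 ω))ᵀ * G.D (ξ 0 ω) + (G.B (ξ 0 ω))ᵀ * P * G.B (ξ 0 ω)).trace ∂μ :=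
  integral_congr_ae (hξ.ae_mem_supp.mono fun ω hω => by
    simp only [System.extend_B hω, System.extend_D hω])

end Extension

end H2

end H2Stoch

theorem theorem3 {Ω : Type*} [MeasurableSpace Ω] (μ : Measure Ω) [IsProbabilityMeasure μ]
    {Z n p q : ℕ} (ξ : ℕ → Ω → EuclideanSpace ℝ (Fin Z)) (G : H2Stoch.System Z n p q)
    (hξ : H2Stoch.IsIID μ ξ) (hG : G.IsSqIntegrable μ ξ) (γ : ℝ) (hγ : 0 < γ) :
    (G.IsExpStable μ ξ → ∃ s : ℝ, Tendsto (G.impulseSum μ ξ) atTop (𝓝 s)) ∧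
    ((G.IsExpStable μ ξ ∧ G.h2Norm μ ξ < γ) ↔
      ∃ P : Matrix (Fin n) (Fin n) ℝ, P.PosDef ∧
        (H2Stoch.matExp μ fun ω =>
          P - (G.A (ξ 0 ω))ᵀ * P * G.A (ξ 0 ω) - (G.C (ξ 0 ω))ᵀ * G.C (ξ 0 ω)).PosDef ∧
        ∫ ω, ((G.D (ξ 0 ω))ᵀ * G.D (ξ 0 ω) + (G.B (ξ 0 ω))ᵀ * P * G.B (ξ 0 ω)).trace ∂μ
          < γ ^ 2) := by
  -- Every quantity in the statement depends on the coefficients only through their almost sure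
  -- values along `ξ`, so the result for the extension is the result for `G`.
  have h := H2Stoch.System.h2_characterization_of_isGlobal hξ (hG.isGlobal_extend hξ) hγ
  simp only [H2Stoch.System.h2Norm, H2Stoch.System.extend_impulseSum hξ,
    H2Stoch.System.extend_isExpStable hξ, H2Stoch.System.extend_matExp hξ,
    H2Stoch.System.extend_cost hξ] at h
  exact h
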